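/- Let $n\ge 2$ be an integer. The unitary Cayley graph $\mathrm{UC}(n)$ has vertex set $\mathbb Z_n$, with $u,v$ adjacent if and only if $\gcd(u-v,n)=1$. For a finite simple graph $G$, let $\mathcal A$ be the set of ordered pairs $(u,v)$ with $uv$ an edge of $G$; for $a=(u,v)\in\mathcal A$ put $t(a)=v$ and $a^{-1}=(v,u)$. Let $d\in\mathbb C^{V(G)\times\mathcal A}$ and $S\in\mathbb C^{\mathcal A\times\mathcal A}$ be the matrices with entries $d_{xa}=\frac{1}{\sqrt{\deg x}}\,\delta_{x,t(a)}$ and $S_{ab}=\delta_{a,b^{-1}}$, and let $U=S(2d^*d-I)$ be the time evolution matrix of the Grover walk on $G$. The graph $G$ is called periodic if $U^\tau=I$ for some positive integer $\tau$; the least such $\tau$ is its period. Then $\mathrm{UC}(n)$ is periodic if and only if $n=2^\alpha 3^\beta$ for some non-negative integers $\alpha,\beta$ with $\alpha+\beta\neq 0$. Moreover, the period of $\mathrm{UC}(n)$ is $4$ if $n=2^\alpha$ with $\alpha\ge 2$; it is $12$ if $n=2^\alpha3^\beta$ with $\alpha\ge 0$, $\beta\ge 1$ and $n\notin\{3,6\}$;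 and it equals $n$ if $n\in\{2,3,6\}$. -/

import Mathlib

namespace GroverWalk

open Matrix

/-- The set `U_n = {a ∈ ℤ_n : gcd(a, n) = 1}`, where `a` is represented by an element of
`{0, 1, …, n - 1}`. -/
def unitSet (n : ℕ) : Set (ZMod n) := {a | Nat.gcd a.val n = 1}

instance (n : ℕ) : DecidablePred (· ∈ unitSet n) :=
  fun a => inferInstanceAs (Decidable (Nat.gcd a.val n = 1))

/-- The unitary Cayley graph `UC(n) = Cay(ℤ_n, U_n)`. For `n ≥ 2` two vertices `u` and `v` are
adjacent if and only if `u - v ∈ U_n`, see `unitaryCayleyGraph_adj`. -/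
def unitaryCayleyGraph (n : ℕ) : SimpleGraph (ZMod n) :=
  SimpleGraph.circulantGraph (unitSet n)

instance (n : ℕ) : DecidableRel (unitaryCayleyGraph n).Adj :=
  inferInstanceAs (DecidableRel (SimpleGraph.circulantGraph (unitSet n)).Adj)

theorem mem_unitSet_iff_isUnit {n : ℕ} [NeZero n] (a : ZMod n) : a ∈ unitSet n ↔ IsUnit a := by
  have h := ZMod.isUnit_iff_coprime a.val n
  rw [ZMod.natCast_zmod_val] at h
  exact h.symm

theorem unitaryCayleyGraph_adj {n : ℕ} (hn : 2 ≤ n) (u v : ZMod n) :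
    (unitaryCayleyGraph n).Adj u v ↔ u - v ∈ unitSet n := by
  have : NeZero n := ⟨by omega⟩
  have : Fact (1 < n) := ⟨hn⟩
  have hsymm : v - u ∈ unitSet n ↔ u - v ∈ unitSet n := by
    rw [mem_unitSet_iff_isUnit, mem_unitSet_iff_isUnit, ← neg_sub, IsUnit.neg_iff]
  have hne : u - v ∈ unitSet n → u ≠ v := by
    rintro h rfl
    rw [mem_unitSet_iff_isUnit, sub_self] at h
    exact not_isUnit_zero h
  simp only [unitaryCayleyGraph, SimpleGraph.circulantGraph_adj, hsymm, or_self]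
  exact ⟨fun h => h.2, fun h => ⟨hne h, h⟩⟩

section

variable {V : Type*} [Fintype V] [DecidableEq V] (G : SimpleGraph V) [DecidableRel G.Adj]

/-- The boundary matrix `d`, with entries `d_{x a} = δ_{x, t(a)} / √(deg x)`. The symmetric arcs
of `G` are its darts, with origin `a.fst`, terminus `a.snd` and inverse `a.symm`. -/
noncomputable def boundaryMatrix : Matrix V G.Dart ℂ :=
  Matrix.of fun x a => (1 / ((Real.sqrt (G.degree x : ℝ) : ℝ) : ℂ)) * (if x = a.snd then 1 else 0)

/-- The shift matrix `S`, with entries `S_{a b} = δ_{a, b⁻¹}`. -/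
def shiftMatrix : Matrix G.Dart G.Dart ℂ :=
  Matrix.of fun a b => if a = b.symm then 1 else 0

/-- The time evolution matrix `U = S (2 d^* d - I)` of the Grover walk on `G`. -/
noncomputable def timeEvolution : Matrix G.Dart G.Dart ℂ :=
  shiftMatrix G * ((2 : ℂ) • ((boundaryMatrix G)ᴴ * boundaryMatrix G) - 1)

/-- `G` is `τ`-periodic: `τ` is the least positive integer with `U ^ τ = I`. -/
def IsPeriodicWithPeriod (τ : ℕ) : Prop :=
  0 < τ ∧ timeEvolution G ^ τ = 1 ∧ ∀ j : ℕ, 0 < j → j < τ → timeEvolution G ^ j ≠ 1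

/-- `G` is periodic: it is `τ`-periodic for some positive integer `τ`. -/
def IsPeriodic : Prop := ∃ τ : ℕ, IsPeriodicWithPeriod G τ

end

end GroverWalk

/-!
Write `P = d S d^*` for the discriminant of the walk; for a regular graph it is the transition
matrix of the simple random walk. Since `d d^* = 1` and `S ^ 2 = 1`, one has `U d^* = S d^*` and
`U ^ 2 d^* = 2 U d^* P - d^*`. So if `P v = (z + z⁻¹) / 2 • v`, then the recursion of the Chebyshev
polynomials gives `d U ^ k d^* v = (z ^ k + z⁻ᵏ) / 2 • v`
(`boundaryMatrix_mulVec_timeEvolution_pow`). This has two consequences.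

* If `U ^ k = 1` then `z ^ k + z⁻ᵏ = 2`, hence `z ^ k = 1`, for every such `z`
  (`pow_eq_one_of_timeEvolution_pow_eq_one`).
* If `k` is even and every eigenvalue of a complete system of eigenvectors of `P` has the form
  `(z + z⁻¹) / 2` with `z ^ k = 1`, then `d U ^ k d^* = 1`, and unitarity of `U` upgrades this to
  `U ^ k = 1` (`timeEvolution_pow_eq_one_of_even`). On the common kernel of `d` and `d S`
  the walk acts as `-S`, which is why `k` has to be even.

For `UC(n)` the additive characters `ψ` of `ZMod n` are a basis of eigenvectors of `P`, with
eigenvalue the average of `ψ` over the units. A prime `p ∣ n` gives the eigenvalue `-1 / (p - 1)`;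
if the walk is periodic, `-2 / (p - 1)` is then a sum of two roots of unity, hence an integer, and
`p ≤ 3`. Conversely, let `n` have only the prime factors `2` and `3`, with product
`r ∈ {2, 3, 6}`. If `ψ r ≠ 1` the eigenvalue is `0`, because translation by the nilpotent element
`r` permutes the units, and `z = I` lies over it. If `ψ r = 1` then, as the units modulo `r` are
`±1`, the eigenvalue is `(z + z⁻¹) / 2` with `z = ψ 1` an `r`-th root of unity. So `U ^ k = 1` for
every even common multiple `k` of `r` and `4`, where `4` is not needed if `n = r`. The same
eigenvalues bound the period from below. The odd period of the triangle `UC(3)` escapes the parity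
argument and is found by computing with the permutation matrix `U`.
-/

namespace GroverWalk

open Matrix

/-! ### The Grover walk and its discriminant -/

section

variable {V : Type*} [Fintype V] [DecidableEq V] (G : SimpleGraph V) [DecidableRel G.Adj]

theorem sum_dart_of_snd_eq (x : V) (F : V → ℂ) :
    ∑ a : G.Dart, (if x = a.snd then F a.fst else 0) = ∑ y ∈ G.neighborFinset x, F y := by
  rw [← Finset.sum_filter]
  refine Finset.sum_bij (fun a _ => a.fst) ?_ ?_ ?_ ?_
  · intro a ha
    rw [Finset.mem_filter] at ha
    rw [SimpleGraph.mem_neighborFinset, ha.2]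
    exact a.adj.symm
  · intro a ha b hb hab
    rw [Finset.mem_filter] at ha hb
    exact SimpleGraph.Dart.ext _ _ (Prod.ext hab (ha.2.symm.trans hb.2))
  · intro y hy
    rw [SimpleGraph.mem_neighborFinset] at hy
    exact ⟨⟨(y, x), hy.symm⟩, by simp, rfl⟩
  · intro a _
    rfl

theorem boundaryMatrix_mul_conjTranspose_self (hG : ∀ x, 0 < G.degree x) :
    boundaryMatrix G * (boundaryMatrix G)ᴴ = 1 := by
  ext x y
  have hs : ((Real.sqrt (G.degree x : ℝ) : ℝ) : ℂ) * ((Real.sqrt (G.degree x : ℝ) : ℝ) : ℂ)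
      = (G.degree x : ℂ) := by
    rw [← Complex.ofReal_mul, Real.mul_self_sqrt (Nat.cast_nonneg _)]
    simp
  have hd : (G.degree x : ℂ) ≠ 0 := Nat.cast_ne_zero.mpr (hG x).ne'
  rw [Matrix.mul_apply]
  rcases eq_or_ne x y with rfl | hxy
  · have h := sum_dart_of_snd_eq G x fun _ => (1 / (G.degree x : ℂ))
    rw [Finset.sum_const, SimpleGraph.card_neighborFinset_eq_degree, nsmul_eq_mul,
      mul_one_div_cancel hd] at h
    rw [Matrix.one_apply_eq, ← h]
    refine Finset.sum_congr rfl fun a _ => ?_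
    by_cases hx : x = a.snd
    · simp only [boundaryMatrix, conjTranspose_apply, of_apply, if_pos hx, mul_one]
      rw [← hs]
      simp
    · simp [boundaryMatrix, if_neg hx]
  · rw [Matrix.one_apply_ne hxy]
    refine Finset.sum_eq_zero fun a _ => ?_
    by_cases hx : x = a.snd
    · have hy : y ≠ a.snd := fun h => hxy (hx.trans h.symm)
      simp [boundaryMatrix, if_neg hy]
    · simp [boundaryMatrix, if_neg hx]

theorem shiftMatrix_mul_apply {W : Type*} (M : Matrix G.Dart W ℂ) (a : G.Dart) (w : W) :
    (shiftMatrix G * M) a w = M a.symm w := by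
  rw [Matrix.mul_apply, Finset.sum_eq_single a.symm]
  · simp [shiftMatrix]
  · intro b _ hb
    have : a ≠ b.symm := by
      rintro rfl
      exact hb (by simp)
    simp [shiftMatrix, this]
  · simp

theorem shiftMatrix_mul_self : shiftMatrix G * shiftMatrix G = 1 := by
  ext a b
  rw [shiftMatrix_mul_apply]
  have : a.symm = b.symm ↔ a = b := SimpleGraph.Dart.symm_involutive.injective.eq_iff
  simp [shiftMatrix, Matrix.one_apply, this]

omit [Fintype V] [DecidableRel G.Adj] in
theorem shiftMatrix_conjTranspose : (shiftMatrix G)ᴴ = shiftMatrix G := by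
  ext a b
  have : b = a.symm ↔ a = b.symm := by
    constructor <;> rintro rfl <;> simp
  simp [shiftMatrix, this, apply_ite]

/-- The discriminant `d S d^*` of the walk. For a regular graph it is the transition matrix of the
simple random walk. -/
noncomputable def discriminant : Matrix V V ℂ :=
  boundaryMatrix G * shiftMatrix G * (boundaryMatrix G)ᴴ

variable {G}

theorem timeEvolution_mul_conjTranspose_boundaryMatrix (hG : ∀ x, 0 < G.degree x) :
    timeEvolution G * (boundaryMatrix G)ᴴ = shiftMatrix G * (boundaryMatrix G)ᴴ := by
  have h := boundaryMatrix_mul_conjTranspose_self G hG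
  rw [timeEvolution, Matrix.mul_assoc, Matrix.sub_mul, Matrix.smul_mul, Matrix.mul_assoc, h,
    Matrix.mul_one, Matrix.one_mul, two_smul, add_sub_cancel_right]

theorem timeEvolution_mul_shiftMatrix :
    timeEvolution G * shiftMatrix G * (boundaryMatrix G)ᴴ =
      (2 : ℂ) • (shiftMatrix G * (boundaryMatrix G)ᴴ * discriminant G) - (boundaryMatrix G)ᴴ := by
  have h := shiftMatrix_mul_self G
  simp only [timeEvolution, discriminant, Matrix.mul_sub, Matrix.sub_mul, Matrix.mul_smul,
    Matrix.smul_mul, Matrix.mul_one, h, Matrix.one_mul, Matrix.mul_assoc]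

/-- The recursion of the Chebyshev polynomials, for the blocks `U ^ k d^*`. -/
theorem timeEvolution_sq_mul (hG : ∀ x, 0 < G.degree x) :
    timeEvolution G * (timeEvolution G * (boundaryMatrix G)ᴴ) =
      (2 : ℂ) • (timeEvolution G * (boundaryMatrix G)ᴴ * discriminant G) - (boundaryMatrix G)ᴴ := by
  rw [timeEvolution_mul_conjTranspose_boundaryMatrix hG, ← Matrix.mul_assoc,
    timeEvolution_mul_shiftMatrix]

theorem conjTranspose_timeEvolution_mul_self (hG : ∀ x, 0 < G.degree x) :
    (timeEvolution G)ᴴ * timeEvolution G = 1 := by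
  set C := (boundaryMatrix G)ᴴ * boundaryMatrix G with hC
  have hCC : C * C = C := by
    rw [hC, Matrix.mul_assoc, ← Matrix.mul_assoc (boundaryMatrix G),
      boundaryMatrix_mul_conjTranspose_self G hG, Matrix.one_mul]
  have hCh : ((2 : ℂ) • C - 1)ᴴ = (2 : ℂ) • C - 1 := by
    simp [hC, Matrix.conjTranspose_sub, Matrix.conjTranspose_smul, Matrix.conjTranspose_mul]
  rw [timeEvolution, ← hC, Matrix.conjTranspose_mul, hCh, shiftMatrix_conjTranspose,
    Matrix.mul_assoc, ← Matrix.mul_assoc (shiftMatrix G), shiftMatrix_mul_self, Matrix.one_mul,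
    Matrix.mul_sub, Matrix.sub_mul, Matrix.mul_smul, Matrix.smul_mul, hCC]
  simp only [two_smul, Matrix.mul_one, Matrix.one_mul]
  abel

/-- The space spanned by `d^* v` and `S d^* v` is invariant under `U`, which acts on it with
eigenvalues `z` and `z⁻¹` if `v` is an eigenvector of the discriminant for `(z + z⁻¹) / 2`. The
right hand side is the Chebyshev polynomial of degree `k` evaluated at that eigenvalue. -/
theorem boundaryMatrix_mulVec_timeEvolution_pow (hG : ∀ x, 0 < G.degree x) {z : ℂ} (hz : z ≠ 0)
    {v : V → ℂ} (hv : discriminant G *ᵥ v = ((z + z⁻¹) / 2) • v) :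
    ∀ k : ℕ, (boundaryMatrix G * timeEvolution G ^ k * (boundaryMatrix G)ᴴ) *ᵥ v =
      ((z ^ k + z⁻¹ ^ k) / 2) • v := by
  have step : ∀ k : ℕ, (boundaryMatrix G * timeEvolution G ^ (k + 2) * (boundaryMatrix G)ᴴ) *ᵥ v =
      (z + z⁻¹) • ((boundaryMatrix G * timeEvolution G ^ (k + 1) * (boundaryMatrix G)ᴴ) *ᵥ v) -
        (boundaryMatrix G * timeEvolution G ^ k * (boundaryMatrix G)ᴴ) *ᵥ v := by
    intro k
    have h : boundaryMatrix G * timeEvolution G ^ (k + 2) * (boundaryMatrix G)ᴴ =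
        (2 : ℂ) • (boundaryMatrix G * timeEvolution G ^ (k + 1) * (boundaryMatrix G)ᴴ *
          discriminant G) - boundaryMatrix G * timeEvolution G ^ k * (boundaryMatrix G)ᴴ := by
      rw [pow_succ, pow_succ]
      simp only [Matrix.mul_assoc]
      rw [timeEvolution_sq_mul hG]
      simp only [Matrix.mul_sub, Matrix.mul_smul, Matrix.mul_assoc]
    rw [h, Matrix.sub_mulVec, Matrix.smul_mulVec, ← Matrix.mulVec_mulVec, hv,
      Matrix.mulVec_smul, smul_smul, mul_div_cancel₀ _ two_ne_zero]
  intro k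
  induction k using Nat.twoStepInduction with
  | zero =>
    rw [pow_zero, Matrix.mul_one, boundaryMatrix_mul_conjTranspose_self G hG]
    simp
  | one =>
    rw [pow_one, Matrix.mul_assoc, timeEvolution_mul_conjTranspose_boundaryMatrix hG,
      ← Matrix.mul_assoc, pow_one, pow_one]
    exact hv
  | more k h0 h1 =>
    rw [step, h0, h1, smul_smul, ← sub_smul]
    congr 1
    simp only [inv_pow]
    field_simp
    ring

/-- The numbers `z` with `(z + z⁻¹) / 2` an eigenvalue of the discriminant obstruct periodicity:
`z ^ k + z⁻¹ ^ k = 2` has `z ^ k = 1` as its only solution. -/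
theorem pow_eq_one_of_timeEvolution_pow_eq_one (hG : ∀ x, 0 < G.degree x) {z : ℂ} (hz : z ≠ 0)
    {v : V → ℂ} (hv0 : v ≠ 0) (hv : discriminant G *ᵥ v = ((z + z⁻¹) / 2) • v) {k : ℕ}
    (hk : timeEvolution G ^ k = 1) : z ^ k = 1 := by
  have h := boundaryMatrix_mulVec_timeEvolution_pow hG hz hv k
  rw [hk, Matrix.mul_one, boundaryMatrix_mul_conjTranspose_self G hG, Matrix.one_mulVec] at h
  have h1 : ((z ^ k + z⁻¹ ^ k) / 2 - 1) • v = 0 := by rw [sub_smul, one_smul, ← h, sub_self]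
  have h2 := (smul_eq_zero.mp h1).resolve_right hv0
  have hzk : z ^ k ≠ 0 := pow_ne_zero _ hz
  rw [inv_pow] at h2
  have h3 : (z ^ k - 1) ^ 2 = 0 := by
    field_simp at h2
    linear_combination h2
  exact sub_eq_zero.mp (pow_eq_zero_iff two_ne_zero |>.mp h3)

open scoped ComplexOrder in
/-- For even `k`, periodicity of `U` can be tested on the range of `d^*`. By unitarity,
`d U ^ k d^* = 1` forces `U ^ k d^* = d^*`; since `U ^ 2 - 1` takes values in the sum of the ranges
of `d^*` and `S d^* = U d^*`, this gives `(U ^ k - 1) ^ 2 = 0`, and `U ^ k - 1` is normal. -/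
theorem timeEvolution_pow_eq_one_of_even (hG : ∀ x, 0 < G.degree x) {k : ℕ} (hk : Even k)
    (h : boundaryMatrix G * timeEvolution G ^ k * (boundaryMatrix G)ᴴ = 1) :
    timeEvolution G ^ k = 1 := by
  set U := timeEvolution G with hU
  set d := boundaryMatrix G with hd
  set S := shiftMatrix G with hS
  have hdd : d * dᴴ = 1 := boundaryMatrix_mul_conjTranspose_self G hG
  have hUd : U * dᴴ = S * dᴴ := timeEvolution_mul_conjTranspose_boundaryMatrix hG
  have hUk : (U ^ k)ᴴ * U ^ k = 1 := by
    have hu : U ∈ unitary (Matrix G.Dart G.Dart ℂ) := by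
      have h1 : Uᴴ * U = 1 := conjTranspose_timeEvolution_mul_self hG
      exact Unitary.mem_iff.mpr ⟨h1, mul_eq_one_comm.mp h1⟩
    exact (Unitary.mem_iff.mp (pow_mem hu k)).1
  have hfix : U ^ k * dᴴ = dᴴ := by
    -- Expanding the Gram matrix of `U ^ k d^* - d^*` leaves `1 - 1 - 1 + 1`.
    have h0 : (U ^ k * dᴴ - dᴴ)ᴴ * (U ^ k * dᴴ - dᴴ) = 0 := by
      have h' : d * (U ^ k)ᴴ * dᴴ = 1 := by
        have := congrArg Matrix.conjTranspose h
        rwa [Matrix.conjTranspose_mul, Matrix.conjTranspose_mul, Matrix.conjTranspose_conjTranspose,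
          Matrix.conjTranspose_one, ← Matrix.mul_assoc] at this
      have h'' : d * (U ^ k)ᴴ * (U ^ k * dᴴ) = 1 := by
        rw [Matrix.mul_assoc, ← Matrix.mul_assoc _ (U ^ k), hUk, Matrix.one_mul, hdd]
      rw [Matrix.conjTranspose_sub, Matrix.conjTranspose_mul, Matrix.conjTranspose_conjTranspose,
        Matrix.sub_mul, Matrix.mul_sub, Matrix.mul_sub, h', h'', ← Matrix.mul_assoc, h, hdd]
      simp
    exact sub_eq_zero.mp (Matrix.conjTranspose_mul_self_eq_zero.mp h0)
  have hfix' : U ^ k * (S * dᴴ) = S * dᴴ := by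
    rw [← hUd, ← Matrix.mul_assoc, ← pow_succ, pow_succ', Matrix.mul_assoc, hfix]
  have hUsq : U * U = (2 : ℂ) • (S * dᴴ * ((2 : ℂ) • (d * S * (dᴴ * d)) - d * S)) -
      (2 : ℂ) • (dᴴ * d) + 1 := by
    have hSS : S * S = 1 := shiftMatrix_mul_self G
    have hSS' : ∀ M : Matrix G.Dart G.Dart ℂ, S * (S * M) = M := fun M => by
      rw [← Matrix.mul_assoc, hSS, Matrix.one_mul]
    rw [hU, timeEvolution, ← hd, ← hS]
    simp only [Matrix.mul_sub, Matrix.sub_mul, Matrix.mul_smul, Matrix.smul_mul, Matrix.mul_one,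
      Matrix.mul_assoc, hSS, hSS', smul_sub]
    abel
  have hzero : (U ^ k - 1) * (U * U - 1) = 0 := by
    have h1 : (U ^ k - 1) * dᴴ = 0 := by rw [Matrix.sub_mul, hfix, Matrix.one_mul, sub_self]
    have h2 : (U ^ k - 1) * (S * dᴴ) = 0 := by
      rw [Matrix.sub_mul, hfix', Matrix.one_mul, sub_self]
    rw [hUsq, add_sub_cancel_right, Matrix.mul_sub, Matrix.mul_smul, Matrix.mul_smul,
      ← Matrix.mul_assoc, h2, ← Matrix.mul_assoc (U ^ k - 1), h1]
    simp
  have hsq : (U ^ k - 1) * (U ^ k - 1) = 0 := by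
    obtain ⟨m, rfl⟩ := hk
    obtain ⟨Q, hQ⟩ : U * U - 1 ∣ U ^ (m + m) - 1 := by
      have h1 := (Commute.one_right (U * U)).mul_geom_sum₂ m
      rw [one_pow, ← pow_two, ← pow_mul, two_mul] at h1
      rw [pow_two U] at h1
      exact ⟨_, h1.symm⟩
    nth_rewrite 2 [hQ]
    rw [← Matrix.mul_assoc, hzero, Matrix.zero_mul]
  have hN : (U ^ k - 1)ᴴ * (U ^ k - 1) = 0 := by
    have h1 : (U ^ k - 1)ᴴ * (U ^ k - 1) = -((U ^ k)ᴴ * ((U ^ k - 1) * (U ^ k - 1))) := by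
      have h2 : (U ^ k)ᴴ * (U ^ k * U ^ k) = U ^ k := by
        rw [← Matrix.mul_assoc, hUk, Matrix.one_mul]
      simp only [Matrix.conjTranspose_sub, Matrix.conjTranspose_one, Matrix.mul_sub, Matrix.sub_mul,
        Matrix.mul_one, Matrix.one_mul, hUk, h2]
      abel
    rw [h1, hsq, Matrix.mul_zero, neg_zero]
  exact sub_eq_zero.mp (Matrix.conjTranspose_mul_self_eq_zero.mp hN)

theorem discriminant_mulVec_of_isRegularOfDegree {r : ℕ} (hr : G.IsRegularOfDegree r) (v : V → ℂ)
    (x : V) : (discriminant G *ᵥ v) x = (r : ℂ)⁻¹ * ∑ y ∈ G.neighborFinset x, v y := by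
  have hs : ((Real.sqrt (r : ℝ) : ℝ) : ℂ) * ((Real.sqrt (r : ℝ) : ℝ) : ℂ) = (r : ℂ) := by
    rw [← Complex.ofReal_mul, Real.mul_self_sqrt (Nat.cast_nonneg _)]
    simp
  have hd : ∀ w : V → ℂ, ∀ a : G.Dart, ((boundaryMatrix G)ᴴ *ᵥ w) a =
      ((Real.sqrt (r : ℝ) : ℝ) : ℂ)⁻¹ * w a.snd := by
    intro w a
    rw [Matrix.mulVec, dotProduct, Finset.sum_eq_single a.snd]
    · simp [boundaryMatrix, hr a.snd]
    · intro b _ hb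
      simp [boundaryMatrix, hb]
    · simp
  have hS : ∀ w : G.Dart → ℂ, ∀ a : G.Dart, (shiftMatrix G *ᵥ w) a = w a.symm := by
    intro w a
    rw [Matrix.mulVec, dotProduct, Finset.sum_eq_single a.symm]
    · simp [shiftMatrix]
    · intro b _ hb
      have : a ≠ b.symm := by
        rintro rfl
        exact hb (by simp)
      simp [shiftMatrix, this]
    · simp
  rw [discriminant, ← Matrix.mulVec_mulVec, ← Matrix.mulVec_mulVec, Finset.mul_sum,
    ← sum_dart_of_snd_eq, Matrix.mulVec, dotProduct]
  refine Finset.sum_congr rfl fun a _ => ?_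
  rw [hS, hd, ← hs]
  by_cases hx : x = a.snd
  · simp [boundaryMatrix, hx, hr a.snd]
    ring
  · simp [boundaryMatrix, hx]

end

/-! ### Characters as eigenvectors for unitary Cayley graphs -/

section

variable {n : ℕ} [NeZero n]

theorem sum_neighborFinset_unitaryCayleyGraph (hn : 2 ≤ n) (x : ZMod n) {M : Type*}
    [AddCommMonoid M] (F : ZMod n → M) :
    ∑ y ∈ (unitaryCayleyGraph n).neighborFinset x, F y = ∑ u : (ZMod n)ˣ, F (x + u) := by
  symm
  refine Finset.sum_bij (fun u _ => x + (u : ZMod n)) ?_ ?_ ?_ ?_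
  · intro u _
    rw [SimpleGraph.mem_neighborFinset, SimpleGraph.adj_comm, unitaryCayleyGraph_adj hn,
      add_sub_cancel_left, mem_unitSet_iff_isUnit]
    exact u.isUnit
  · intro u _ w _ h
    exact Units.ext (add_left_cancel h)
  · intro y hy
    rw [SimpleGraph.mem_neighborFinset, SimpleGraph.adj_comm, unitaryCayleyGraph_adj hn,
      mem_unitSet_iff_isUnit] at hy
    exact ⟨hy.unit, Finset.mem_univ _, by simp⟩
  · intro u _
    rfl

theorem unitaryCayleyGraph_isRegularOfDegree (hn : 2 ≤ n) :
    (unitaryCayleyGraph n).IsRegularOfDegree n.totient := by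
  intro x
  have h := sum_neighborFinset_unitaryCayleyGraph hn x fun _ => 1
  rw [← SimpleGraph.card_neighborFinset_eq_degree, Finset.card_eq_sum_ones, h,
    Finset.sum_const, Finset.card_univ, ZMod.card_units_eq_totient, smul_eq_mul, mul_one]

theorem degree_unitaryCayleyGraph_pos (hn : 2 ≤ n) (x : ZMod n) :
    0 < (unitaryCayleyGraph n).degree x := by
  rw [unitaryCayleyGraph_isRegularOfDegree hn x]
  exact Nat.totient_pos.mpr (by omega)

theorem discriminant_mulVec_addChar (hn : 2 ≤ n) (ψ : AddChar (ZMod n) ℂ) :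
    discriminant (unitaryCayleyGraph n) *ᵥ ⇑ψ =
      ((n.totient : ℂ)⁻¹ * ∑ u : (ZMod n)ˣ, ψ u) • ⇑ψ := by
  ext x
  rw [discriminant_mulVec_of_isRegularOfDegree (unitaryCayleyGraph_isRegularOfDegree hn),
    sum_neighborFinset_unitaryCayleyGraph hn]
  simp only [AddChar.map_add_eq_mul, ← Finset.mul_sum, Pi.smul_apply, smul_eq_mul]
  ring

omit [NeZero n] in
theorem addChar_ne_zero (ψ : AddChar (ZMod n) ℂ) : (⇑ψ : ZMod n → ℂ) ≠ 0 := by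
  intro h
  have := congrFun h 0
  simp at this

/-- Translation by a nilpotent element permutes the units. -/
theorem sum_units_addChar_eq_zero (ψ : AddChar (ZMod n) ℂ) {h : ZMod n} (hh : IsNilpotent h)
    (hψ : ψ h ≠ 1) : ∑ u : (ZMod n)ˣ, ψ u = 0 := by
  have hshift : ∑ u : (ZMod n)ˣ, ψ ((u : ZMod n) + h) = ∑ u : (ZMod n)ˣ, ψ u := by
    refine Fintype.sum_equiv
      { toFun := fun u => (hh.isUnit_add_left_of_commute u.isUnit (Commute.all _ _)).unit
        invFun := fun u => (hh.neg.isUnit_add_left_of_commute u.isUnit (Commute.all _ _)).unit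
        left_inv := fun u => Units.ext (by simp)
        right_inv := fun u => Units.ext (by simp) } _ _ fun u => ?_
    simp
  simp only [AddChar.map_add_eq_mul, ← Finset.sum_mul] at hshift
  have h1 : (∑ u : (ZMod n)ˣ, ψ u) * (ψ h - 1) = 0 := by rw [mul_sub, hshift, mul_one, sub_self]
  exact (mul_eq_zero.mp h1).resolve_right (sub_ne_zero.mpr hψ)

/-- Pairing `u` with `-u`, every pair contributes `ψ 1 + ψ (-1)` to the sum. -/
theorem inv_totient_mul_sum_units_addChar (ψ : AddChar (ZMod n) ℂ)
    (hψ : ∀ u : (ZMod n)ˣ, ψ u = ψ 1 ∨ ψ u = ψ (-1)) :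
    (n.totient : ℂ)⁻¹ * ∑ u : (ZMod n)ˣ, ψ u = (ψ 1 + (ψ 1)⁻¹) / 2 := by
  have hneg : ∑ u : (ZMod n)ˣ, ψ (-(u : ZMod n)) = ∑ u : (ZMod n)ˣ, ψ u :=
    Fintype.sum_equiv (Equiv.neg _) _ _ fun u => by simp
  have hpair : ∀ u : (ZMod n)ˣ, ψ u + ψ (-(u : ZMod n)) = ψ 1 + (ψ 1)⁻¹ := by
    intro u
    rw [AddChar.map_neg_eq_inv]
    rcases hψ u with h | h
    · rw [h]
    · rw [h, AddChar.map_neg_eq_inv, inv_inv, add_comm]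
  have h2 : 2 * ∑ u : (ZMod n)ˣ, ψ u = n.totient * (ψ 1 + (ψ 1)⁻¹) := by
    rw [two_mul]
    nth_rewrite 2 [← hneg]
    rw [← Finset.sum_add_distrib, Finset.sum_congr rfl fun u _ => hpair u, Finset.sum_const,
      Finset.card_univ, ZMod.card_units_eq_totient, nsmul_eq_mul]
  have h0 : (n.totient : ℂ) ≠ 0 :=
    Nat.cast_ne_zero.mpr (Nat.totient_pos.mpr (Nat.pos_of_ne_zero (NeZero.ne n))).ne'
  rw [inv_mul_eq_div, div_eq_div_iff h0 two_ne_zero]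
  linear_combination h2

/-- If the eigenvalue of every character is `(z + z⁻¹) / 2` with `z ^ k = 1`, then `d U ^ k d^*`
fixes every character, and the characters form a basis. -/
theorem timeEvolution_pow_eq_one_of_addChar (hn : 2 ≤ n) {k : ℕ} (hk : Even k)
    (h : ∀ ψ : AddChar (ZMod n) ℂ, ∃ z : ℂ, z ^ k = 1 ∧ z ≠ 0 ∧
      (n.totient : ℂ)⁻¹ * ∑ u : (ZMod n)ˣ, ψ u = (z + z⁻¹) / 2) :
    timeEvolution (unitaryCayleyGraph n) ^ k = 1 := by
  have hG := degree_unitaryCayleyGraph_pos hn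
  refine timeEvolution_pow_eq_one_of_even hG hk ?_
  apply Matrix.toLin'.injective
  refine (AddChar.complexBasis (ZMod n)).ext fun ψ => ?_
  obtain ⟨z, hz, hz0, hψ⟩ := h ψ
  have h1 := discriminant_mulVec_addChar hn ψ
  rw [hψ] at h1
  rw [AddChar.complexBasis_apply, Matrix.toLin'_apply, Matrix.toLin'_apply, Matrix.one_mulVec,
    boundaryMatrix_mulVec_timeEvolution_pow hG hz0 h1, inv_pow, hz]
  simp

omit [NeZero n] in
theorem addChar_natCast_mul (ψ : AddChar (ZMod n) ℂ) (r : ℕ) (a : ZMod n) :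
    ψ (r * a) = ψ a ^ r := by
  rw [← nsmul_eq_mul, AddChar.map_nsmul_eq_pow]

/-- If `r ∣ n` has the same prime factors as `n`, and `1`, `-1` are the only residues prime to `r`,
then every character of `ZMod n` either has eigenvalue `0`, coming from the fourth root of unity
`z = I`, or factors through `ZMod r` and has eigenvalue `(z + z⁻¹) / 2` with `z ^ r = 1`. -/
theorem timeEvolution_pow_eq_one_of_radical (hn : 2 ≤ n) {r k : ℕ} (hr : r ∣ n)
    (hnil : IsNilpotent (r : ZMod n)) (hunit : ∀ u : (ZMod r)ˣ, u = 1 ∨ u = -1) (hk : Even k)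
    (hrk : r ∣ k) (h4 : r = n ∨ 4 ∣ k) : timeEvolution (unitaryCayleyGraph n) ^ k = 1 := by
  refine timeEvolution_pow_eq_one_of_addChar hn hk fun ψ => ?_
  have h0 : ψ 1 ≠ 0 := (ψ.val_isUnit 1).ne_zero
  by_cases hψ : ψ (r : ZMod n) = 1
  · have hψr : ψ 1 ^ r = 1 := by rw [← addChar_natCast_mul, mul_one, hψ]
    obtain ⟨m, rfl⟩ := hrk
    refine ⟨ψ 1, by rw [pow_mul, hψr, one_pow], h0, ?_⟩
    refine inv_totient_mul_sum_units_addChar ψ fun u => ?_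
    -- `ψ` is trivial on the multiples of `r`, that is, on the kernel of the reduction modulo `r`.
    have key : ∀ b : ZMod n, ZMod.castHom hr (ZMod r) b = 0 → ψ b = 1 := by
      intro b hb
      rw [ZMod.castHom_apply, ← ZMod.natCast_val, ZMod.natCast_eq_zero_iff] at hb
      obtain ⟨c, hc⟩ := hb
      rw [← ZMod.natCast_zmod_val b, hc, Nat.cast_mul, mul_comm, addChar_natCast_mul, hψ,
        one_pow]
    have hsub : ∀ a : ZMod n, ZMod.castHom hr (ZMod r) ((u : ZMod n) - a) = 0 → ψ u = ψ a := by
      intro a ha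
      have := key _ ha
      rw [← sub_add_cancel (u : ZMod n) a, AddChar.map_add_eq_mul, this, one_mul]
    rcases hunit (ZMod.unitsMap hr u) with h | h
    · refine Or.inl (hsub _ ?_)
      have := congrArg Units.val h
      rw [ZMod.unitsMap_val] at this
      rw [map_sub, ZMod.castHom_apply, this, map_one, Units.val_one, sub_self]
    · refine Or.inr (hsub _ ?_)
      have := congrArg Units.val h
      rw [ZMod.unitsMap_val] at this
      rw [map_sub, ZMod.castHom_apply, this, map_neg, map_one, Units.val_neg, Units.val_one,
        sub_self]
  · have h4k : 4 ∣ k := by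
      refine h4.resolve_left fun h => hψ ?_
      rw [h, ZMod.natCast_self, AddChar.map_zero_eq_one]
    obtain ⟨m, rfl⟩ := h4k
    refine ⟨Complex.I, by rw [pow_mul, Complex.I_pow_four, one_pow], Complex.I_ne_zero, ?_⟩
    rw [sum_units_addChar_eq_zero ψ hnil hψ]
    simp

omit [NeZero n] in
theorem isNilpotent_natCast_of_dvd_pow {r m : ℕ} (h : n ∣ r ^ m) : IsNilpotent (r : ZMod n) :=
  ⟨m, by rw [← Nat.cast_pow, (ZMod.natCast_eq_zero_iff _ _).mpr h]⟩

/-! ### Obstructions to periodicity -/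

/-- If `p ^ 2 ∣ n` then `0` is an eigenvalue of the discriminant, with `I` lying over it. -/
theorem four_dvd_of_timeEvolution_pow_eq_one (hn : 2 ≤ n) {p k : ℕ} (hp : 2 ≤ p) (hpn : p ^ 2 ∣ n)
    (hk : timeEvolution (unitaryCayleyGraph n) ^ k = 1) : 4 ∣ k := by
  obtain ⟨m, hm⟩ := hpn
  have hm0 : 0 < m := Nat.pos_of_ne_zero fun h => NeZero.ne n (by rw [hm, h, mul_zero])
  -- `n / p` is nilpotent and nonzero, so the faithful character is nontrivial there.
  have hnil : IsNilpotent ((p * m : ℕ) : ZMod n) :=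
    isNilpotent_natCast_of_dvd_pow (m := 2) ⟨m, by rw [hm]; ring⟩
  have hne : ((p * m : ℕ) : ZMod n) ≠ 0 := by
    rw [Ne, ZMod.natCast_eq_zero_iff]
    intro h
    have := Nat.le_of_dvd (by positivity) h
    nlinarith [Nat.mul_pos (show 0 < p by omega) hm0]
  have hψ : ZMod.stdAddChar ((p * m : ℕ) : ZMod n) ≠ 1 := by
    intro h
    exact hne (ZMod.injective_stdAddChar (h.trans (AddChar.map_zero_eq_one _).symm))
  have h1 := discriminant_mulVec_addChar hn ZMod.stdAddChar
  rw [sum_units_addChar_eq_zero _ hnil hψ] at h1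
  have hI := pow_eq_one_of_timeEvolution_pow_eq_one (degree_unitaryCayleyGraph_pos hn)
    Complex.I_ne_zero (addChar_ne_zero _) (h1.trans (by simp)) hk
  exact (Complex.isPrimitiveRoot_I).dvd_of_pow_eq_one k hI

/-- Averaging over lifts of the units of `ZMod p` replaces the sum over the units of `ZMod n` by
sums over the nonzero residues modulo `p`. -/
theorem sum_units_addChar_unitsMap {p : ℕ} [Fact p.Prime] (hpn : p ∣ n)
    {χ : AddChar (ZMod p) ℂ} (hχ : χ ≠ 1) :
    ((p : ℂ) - 1) * ∑ u : (ZMod n)ˣ, χ (ZMod.unitsMap hpn u : ZMod p) = -n.totient := by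
  have hsum : ∑ w : (ZMod p)ˣ, χ w = -1 := by
    rw [Fintype.sum_equiv unitsEquivNeZero (fun w : (ZMod p)ˣ => χ w)
      (fun a : {a : ZMod p // a ≠ 0} => χ a) fun w => rfl,
      ← Finset.sum_subtype (Finset.univ.erase 0) (by simp) χ]
    have h1 := Finset.add_sum_erase Finset.univ χ (Finset.mem_univ 0)
    rw [AddChar.sum_eq_zero_of_ne_one hχ, AddChar.map_zero_eq_one] at h1
    linear_combination h1
  have hmul : ∀ w : (ZMod p)ˣ, ∑ u : (ZMod n)ˣ, χ ((w * ZMod.unitsMap hpn u : (ZMod p)ˣ) : ZMod p) =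
      ∑ u : (ZMod n)ˣ, χ (ZMod.unitsMap hpn u : ZMod p) := by
    intro w
    obtain ⟨w', rfl⟩ := ZMod.unitsMap_surjective hpn w
    exact Fintype.sum_equiv (Equiv.mulLeft w') _ _ fun u => by simp
  have h1 : ∑ w : (ZMod p)ˣ, ∑ u : (ZMod n)ˣ, χ ((w * ZMod.unitsMap hpn u : (ZMod p)ˣ) : ZMod p) =
      ((p : ℂ) - 1) * ∑ u : (ZMod n)ˣ, χ (ZMod.unitsMap hpn u : ZMod p) := by
    rw [Finset.sum_congr rfl fun w _ => hmul w, Finset.sum_const, Finset.card_univ,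
      ZMod.card_units, nsmul_eq_mul, Nat.cast_sub (Fact.out : p.Prime).one_le, Nat.cast_one]
  have h2 : ∀ u : (ZMod n)ˣ,
      ∑ w : (ZMod p)ˣ, χ ((w * ZMod.unitsMap hpn u : (ZMod p)ˣ) : ZMod p) = -1 := by
    intro u
    rw [← hsum]
    exact Fintype.sum_equiv (Equiv.mulRight (ZMod.unitsMap hpn u)) _ _ fun w => by simp
  rw [← h1, Finset.sum_comm, Finset.sum_congr rfl fun u _ => h2 u, Finset.sum_const,
    Finset.card_univ, ZMod.card_units_eq_totient, nsmul_eq_mul, mul_neg, mul_one]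

/-- For a prime `p ∣ n`, a nontrivial character of `ZMod p` pulled back to `ZMod n` has the
eigenvalue `-1 / (p - 1)`; hypothesis `hz` says that this is `(z + z⁻¹) / 2`. -/
theorem pow_eq_one_of_prime_dvd (hn : 2 ≤ n) {p k : ℕ} [hp : Fact p.Prime] (hpn : p ∣ n)
    (hk : timeEvolution (unitaryCayleyGraph n) ^ k = 1) {z : ℂ} (hz0 : z ≠ 0)
    (hz : ((p : ℂ) - 1) * (z + z⁻¹) = -2) : z ^ k = 1 := by
  set ψ : AddChar (ZMod n) ℂ :=
    (ZMod.stdAddChar (N := p)).compAddMonoidHom (ZMod.castHom hpn (ZMod p)).toAddMonoidHom with hψ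
  have hχ : (ZMod.stdAddChar : AddChar (ZMod p) ℂ) ≠ 1 := by
    intro h
    exact one_ne_zero (ZMod.injective_stdAddChar (by rw [h]; simp) : (1 : ZMod p) = 0)
  have hs := sum_units_addChar_unitsMap hpn hχ
  have h1 := discriminant_mulVec_addChar hn ψ
  have hp1 : (p : ℂ) - 1 ≠ 0 := sub_ne_zero.mpr (Nat.cast_ne_one.mpr hp.out.one_lt.ne')
  have h0 : (n.totient : ℂ) ≠ 0 :=
    Nat.cast_ne_zero.mpr (Nat.totient_pos.mpr (Nat.pos_of_ne_zero (NeZero.ne n))).ne'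
  have h2 : (n.totient : ℂ)⁻¹ * ∑ u : (ZMod n)ˣ, ψ u = (z + z⁻¹) / 2 := by
    have h3 : ∑ u : (ZMod n)ˣ, ψ u =
        ∑ u : (ZMod n)ˣ, ZMod.stdAddChar (ZMod.unitsMap hpn u : ZMod p) := rfl
    rw [h3, inv_mul_eq_div, div_eq_div_iff h0 two_ne_zero]
    apply mul_left_cancel₀ hp1
    linear_combination 2 * hs - n.totient * hz
  rw [h2] at h1
  exact pow_eq_one_of_timeEvolution_pow_eq_one (degree_unitaryCayleyGraph_pos hn) hz0
    (addChar_ne_zero _) h1 hk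

theorem two_dvd_of_timeEvolution_pow_eq_one (hn : 2 ≤ n) {k : ℕ} (h2n : 2 ∣ n)
    (hk : timeEvolution (unitaryCayleyGraph n) ^ k = 1) : 2 ∣ k := by
  have : Fact (Nat.Prime 2) := ⟨Nat.prime_two⟩
  have h := pow_eq_one_of_prime_dvd hn h2n hk (z := -1) (by norm_num) (by norm_num)
  exact (IsPrimitiveRoot.neg_one 0 (by norm_num)).dvd_of_pow_eq_one k h

theorem three_dvd_of_timeEvolution_pow_eq_one (hn : 2 ≤ n) {k : ℕ} (h3n : 3 ∣ n)
    (hk : timeEvolution (unitaryCayleyGraph n) ^ k = 1) : 3 ∣ k := by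
  have : Fact (Nat.Prime 3) := ⟨Nat.prime_three⟩
  have hω := Complex.isPrimitiveRoot_exp 3 (by norm_num)
  set ω := Complex.exp (2 * Real.pi * Complex.I / (3 : ℕ))
  have hω0 : ω ≠ 0 := hω.ne_zero (by norm_num)
  have hsum := hω.geom_sum_eq_zero (by norm_num)
  simp only [Finset.sum_range_succ, Finset.sum_range_zero, pow_zero, pow_one, zero_add] at hsum
  refine hω.dvd_of_pow_eq_one k (pow_eq_one_of_prime_dvd hn h3n hk hω0 ?_)
  have : ω + ω⁻¹ = -1 := by
    field_simp
    linear_combination hsum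
  rw [this]
  norm_num

/-- For a prime `p ∣ n` the number `-2 / (p - 1)` is a sum of two roots of unity, hence an
integer. -/
theorem eq_two_or_three_of_prime_dvd (hn : 2 ≤ n) {p k : ℕ} (hp : p.Prime) (hpn : p ∣ n)
    (hk0 : 0 < k) (hk : timeEvolution (unitaryCayleyGraph n) ^ k = 1) : p = 2 ∨ p = 3 := by
  have : Fact p.Prime := ⟨hp⟩
  have hp1 : (p : ℂ) - 1 ≠ 0 := sub_ne_zero.mpr (Nat.cast_ne_one.mpr hp.one_lt.ne')
  -- `l + s` and `l - s` are the two roots of `X ^ 2 - 2 * l * X + 1`.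
  obtain ⟨s, hs⟩ := IsAlgClosed.exists_pow_nat_eq ((-1 / ((p : ℂ) - 1)) ^ 2 - 1) zero_lt_two
  set l : ℂ := -1 / ((p : ℂ) - 1) with hl
  have hmul : (l + s) * (l - s) = 1 := by linear_combination -hs
  have hz0 : l + s ≠ 0 := left_ne_zero_of_mul_eq_one hmul
  have hinv : (l + s)⁻¹ = l - s := inv_eq_of_mul_eq_one_right hmul
  have hsum : l + s + (l + s)⁻¹ = -2 / ((p : ℂ) - 1) := by
    rw [hinv, hl]
    ring
  have hz := pow_eq_one_of_prime_dvd hn hpn hk hz0 (by rw [hsum]; field_simp)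
  have hint : ∀ w : ℂ, w ^ k = 1 → IsIntegral ℤ w := fun w hw =>
    IsIntegral.of_pow hk0 (by rw [hw]; exact isIntegral_one)
  have hI : IsIntegral ℤ (algebraMap ℚ ℂ (-2 / ((p : ℚ) - 1))) := by
    have h1 := (hint _ hz).add (hint (l + s)⁻¹ (by rw [inv_pow, hz, inv_one]))
    rw [hsum] at h1
    simpa using h1
  rw [isIntegral_algebraMap_iff (algebraMap ℚ ℂ).injective] at hI
  obtain ⟨c, hc⟩ := IsIntegrallyClosed.isIntegral_iff.mp hI
  have hp1' : (p : ℚ) - 1 ≠ 0 := sub_ne_zero.mpr (Nat.cast_ne_one.mpr hp.one_lt.ne')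
  have hcp : c * ((p : ℤ) - 1) = -2 := by
    have : (c : ℚ) * ((p : ℚ) - 1) = -2 := by
      rw [show (c : ℚ) = -2 / ((p : ℚ) - 1) from hc]
      field_simp
    exact_mod_cast this
  have hdvd : (p : ℤ) - 1 ∣ 2 := ⟨-c, by linear_combination hcp⟩
  have hle := Int.le_of_dvd two_pos hdvd
  have := hp.two_le
  omega

end

/-! ### The triangle -/

section

variable {V : Type*} [Fintype V] [DecidableEq V] {G : SimpleGraph V} [DecidableRel G.Adj]

/-- On a `2`-regular graph the walk moves every arc to the next one without backtracking. -/
theorem timeEvolution_of_isRegularOfDegree_two (hG : G.IsRegularOfDegree 2) :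
    timeEvolution G =
      (Matrix.of fun a b : G.Dart => if a.fst = b.snd ∧ a ≠ b.symm then (1 : ℤ) else 0).map
        (Int.castRingHom ℂ) := by
  have hs : ((Real.sqrt (2 : ℕ) : ℝ) : ℂ) * ((Real.sqrt (2 : ℕ) : ℝ) : ℂ) = 2 := by
    rw [← Complex.ofReal_mul, Real.mul_self_sqrt (Nat.cast_nonneg _)]
    simp
  have hC : ∀ a b : G.Dart, ((boundaryMatrix G)ᴴ * boundaryMatrix G) a b =
      2⁻¹ * if a.snd = b.snd then 1 else 0 := by
    intro a b
    rw [Matrix.mul_apply, Finset.sum_eq_single a.snd]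
    · rw [← hs]
      simp only [boundaryMatrix, conjTranspose_apply, of_apply, hG a.snd, if_true, mul_one, one_div,
        star_inv₀, mul_inv, RCLike.star_def, Complex.conj_ofReal, mul_assoc]
    · intro x _ hx
      simp [boundaryMatrix, hx]
    · simp
  ext a b
  rw [timeEvolution, shiftMatrix_mul_apply, Matrix.sub_apply, Matrix.smul_apply, hC,
    Matrix.one_apply, Matrix.map_apply, Matrix.of_apply]
  have h1 : a.symm = b ↔ a = b.symm := by
    constructor <;> rintro rfl <;> simp
  have h2 : a.symm.snd = a.fst := rfl
  rw [h2]
  simp only [h1]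
  by_cases hab : a = b.symm
  · have : a.fst = b.snd := by rw [hab]; rfl
    simp [hab]
  · simp [hab]

end

theorem timeEvolution_unitaryCayleyGraph_three_pow :
    timeEvolution (unitaryCayleyGraph 3) ^ 3 = 1 := by
  rw [timeEvolution_of_isRegularOfDegree_two
    (unitaryCayleyGraph_isRegularOfDegree (n := 3) (by norm_num)), ← Matrix.map_pow]
  have h : (Matrix.of fun a b : (unitaryCayleyGraph 3).Dart =>
      if a.fst = b.snd ∧ a ≠ b.symm then (1 : ℤ) else 0) ^ 3 = 1 := by
    decide +kernel
  rw [h]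
  simp

/-! ### The periods -/

theorem isPeriodicWithPeriod_of_dvd {n τ : ℕ} [NeZero n] (hτ : 0 < τ)
    (h1 : timeEvolution (unitaryCayleyGraph n) ^ τ = 1)
    (h2 : ∀ j, timeEvolution (unitaryCayleyGraph n) ^ j = 1 → τ ∣ j) :
    IsPeriodicWithPeriod (unitaryCayleyGraph n) τ :=
  ⟨hτ, h1, fun j hj hjτ h => (Nat.le_of_dvd hj (h2 j h)).not_gt hjτ⟩

theorem units_zmod_two (u : (ZMod 2)ˣ) : u = 1 ∨ u = -1 := by revert u; decide

theorem units_zmod_three (u : (ZMod 3)ˣ) : u = 1 ∨ u = -1 := by revert u; decide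

theorem units_zmod_six (u : (ZMod 6)ˣ) : u = 1 ∨ u = -1 := by revert u; decide

theorem period_two_pow {n α : ℕ} [NeZero n] (hα : 2 ≤ α) (h : n = 2 ^ α) :
    IsPeriodicWithPeriod (unitaryCayleyGraph n) 4 := by
  have h4 : 2 ^ 2 ∣ n := h ▸ pow_dvd_pow 2 hα
  have hn : 2 ≤ n := Nat.le_of_dvd (Nat.pos_of_ne_zero (NeZero.ne n))
    ((by norm_num : 2 ∣ 2 ^ 2).trans h4)
  refine isPeriodicWithPeriod_of_dvd (by norm_num) ?_ fun j hj =>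
    four_dvd_of_timeEvolution_pow_eq_one hn le_rfl h4 hj
  exact timeEvolution_pow_eq_one_of_radical hn (r := 2) (h ▸ dvd_pow_self 2 (by omega))
    (isNilpotent_natCast_of_dvd_pow (m := α) h.dvd) units_zmod_two (by decide) (by norm_num)
    (Or.inr dvd_rfl)

theorem period_two_pow_mul_three_pow {n α β : ℕ} [NeZero n] (hβ : 1 ≤ β) (h : n = 2 ^ α * 3 ^ β)
    (h3 : n ≠ 3) (h6 : n ≠ 6) : IsPeriodicWithPeriod (unitaryCayleyGraph n) 12 := by
  have h3n : 3 ∣ n := h ▸ Dvd.dvd.mul_left (dvd_pow_self 3 (by omega)) _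
  have hn : 2 ≤ n := by
    have := Nat.le_of_dvd (Nat.pos_of_ne_zero (NeZero.ne n)) h3n
    omega
  refine isPeriodicWithPeriod_of_dvd (by norm_num) ?_ fun j hj => ?_
  · rcases Nat.eq_zero_or_pos α with rfl | hα
    · refine timeEvolution_pow_eq_one_of_radical hn (r := 3) h3n
        (isNilpotent_natCast_of_dvd_pow (m := β) ?_) units_zmod_three (by decide) (by norm_num)
        (Or.inr (by norm_num))
      rw [h, pow_zero, one_mul]
    · refine timeEvolution_pow_eq_one_of_radical hn (r := 6) ?_
        (isNilpotent_natCast_of_dvd_pow (m := α + β) ?_) units_zmod_six (by decide) (by norm_num)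
        (Or.inr (by norm_num))
      · rw [h, show 6 = 2 * 3 from rfl]
        exact mul_dvd_mul (dvd_pow_self 2 hα.ne') (dvd_pow_self 3 (by omega))
      · rw [h, show 6 = 2 * 3 from rfl, mul_pow]
        exact mul_dvd_mul (pow_dvd_pow 2 (by omega)) (pow_dvd_pow 3 (by omega))
  · have h3j := three_dvd_of_timeEvolution_pow_eq_one hn h3n hj
    have h4j : 4 ∣ j := by
      by_cases hβ2 : 2 ≤ β
      · exact four_dvd_of_timeEvolution_pow_eq_one hn (p := 3) (by norm_num)
          (h ▸ Dvd.dvd.mul_left (pow_dvd_pow 3 hβ2) _) hj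
      · obtain rfl : β = 1 := by omega
        -- `α ≤ 1` would give `n = 3` or `n = 6`.
        have hα : 2 ≤ α := by
          by_contra hα
          interval_cases α <;> omega
        exact four_dvd_of_timeEvolution_pow_eq_one hn (p := 2) le_rfl
          (h ▸ Dvd.dvd.mul_right (pow_dvd_pow 2 hα) _) hj
    omega

theorem isPeriodicWithPeriod_self {n : ℕ} [NeZero n] (h : n = 2 ∨ n = 3 ∨ n = 6) :
    IsPeriodicWithPeriod (unitaryCayleyGraph n) n := by
  have hnil : IsNilpotent (n : ZMod n) := by rw [ZMod.natCast_self]; exact IsNilpotent.zero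
  rcases h with rfl | rfl | rfl
  · exact isPeriodicWithPeriod_of_dvd (by norm_num)
      (timeEvolution_pow_eq_one_of_radical le_rfl dvd_rfl hnil units_zmod_two (by decide) dvd_rfl
        (Or.inl rfl))
      fun j hj => two_dvd_of_timeEvolution_pow_eq_one le_rfl dvd_rfl hj
  · refine isPeriodicWithPeriod_of_dvd (by norm_num) ?_
      fun j hj => three_dvd_of_timeEvolution_pow_eq_one (by norm_num) dvd_rfl hj
    convert timeEvolution_unitaryCayleyGraph_three_pow
  · refine isPeriodicWithPeriod_of_dvd (by norm_num)
      (timeEvolution_pow_eq_one_of_radical (by norm_num) dvd_rfl hnil units_zmod_six (by decide)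
        dvd_rfl (Or.inl rfl))
      fun j hj => ?_
    have h2 := two_dvd_of_timeEvolution_pow_eq_one (by norm_num) (by norm_num) hj
    have h3 := three_dvd_of_timeEvolution_pow_eq_one (by norm_num) (by norm_num) hj
    omega

theorem exists_eq_two_pow_mul_three_pow {n : ℕ} (hn : 2 ≤ n)
    (h : ∀ p : ℕ, p.Prime → p ∣ n → p = 2 ∨ p = 3) :
    ∃ α β : ℕ, α + β ≠ 0 ∧ n = 2 ^ α * 3 ^ β := by
  have hn0 : n ≠ 0 := by omega
  obtain ⟨a, m, hm, rfl⟩ := Nat.exists_eq_pow_mul_and_not_dvd hn0 2 (by norm_num)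
  have hm0 : m ≠ 0 := right_ne_zero_of_mul hn0
  obtain ⟨b, l, hl, rfl⟩ := Nat.exists_eq_pow_mul_and_not_dvd hm0 3 (by norm_num)
  have hl1 : l = 1 := by
    by_contra hl1
    obtain ⟨p, hp, hpl⟩ := Nat.exists_prime_and_dvd hl1
    rcases h p hp (Dvd.dvd.mul_left (Dvd.dvd.mul_left hpl _) _) with rfl | rfl
    · exact hm (Dvd.dvd.mul_left hpl _)
    · exact hl hpl
  subst hl1
  refine ⟨a, b, fun hab => ?_, by rw [mul_one]⟩
  obtain ⟨rfl, rfl⟩ : a = 0 ∧ b = 0 := by omega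
  norm_num at hn

end GroverWalk

/-- Characterization of the unitary Cayley graphs with a periodic Grover walk, and their periods. -/
theorem theorem3p6 (n : ℕ) [NeZero n] (hn : 2 ≤ n) :
    (GroverWalk.IsPeriodic (GroverWalk.unitaryCayleyGraph n) ↔
      ∃ α β : ℕ, α + β ≠ 0 ∧ n = 2 ^ α * 3 ^ β) ∧
    (∀ α : ℕ, 2 ≤ α → n = 2 ^ α →
      GroverWalk.IsPeriodicWithPeriod (GroverWalk.unitaryCayleyGraph n) 4) ∧
    (∀ α β : ℕ, 1 ≤ β → n = 2 ^ α * 3 ^ β → n ≠ 3 → n ≠ 6 →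
      GroverWalk.IsPeriodicWithPeriod (GroverWalk.unitaryCayleyGraph n) 12) ∧
    (n = 2 ∨ n = 3 ∨ n = 6 →
      GroverWalk.IsPeriodicWithPeriod (GroverWalk.unitaryCayleyGraph n) n) := by
  refine ⟨⟨?_, ?_⟩, fun α => GroverWalk.period_two_pow,
    fun α β => GroverWalk.period_two_pow_mul_three_pow, GroverWalk.isPeriodicWithPeriod_self⟩
  · rintro ⟨τ, hτ, h1, -⟩
    exact GroverWalk.exists_eq_two_pow_mul_three_pow hn fun p hp hpn =>
      GroverWalk.eq_two_or_three_of_prime_dvd hn hp hpn hτ h1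
  · rintro ⟨α, β, hαβ, h⟩
    by_cases hsmall : n = 2 ∨ n = 3 ∨ n = 6
    · exact ⟨n, GroverWalk.isPeriodicWithPeriod_self hsmall⟩
    push Not at hsmall
    rcases Nat.eq_zero_or_pos β with rfl | hβ
    · rw [pow_zero, mul_one] at h
      have hα : α ≠ 1 := by
        rintro rfl
        exact hsmall.1 h
      exact ⟨4, GroverWalk.period_two_pow (by omega) h⟩
    · exact ⟨12, GroverWalk.period_two_pow_mul_three_pow hβ h hsmall.2.1 hsmall.2.2⟩
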